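/- Let $p$ be a prime, let $k$ be a perfect field of characteristic $p$, and let $K$ be a finite extension of $W(k)[1/p]$, where $W(k)$ is the ring of $p$-typical Witt vectors of $k$ (for instance, $K$ a finite extension of $\mathbf{Q}_p$, or a finite totally ramified extension of $W(k)[1/p]$). Let $\mathcal{O}_K$ be the ring of integers of $K$, let $\mathbf{C}_p$ be the completion of an algebraic closure of $K$ for the absolute value extending the $p$-adic absolute value of $W(k)[1/p]$, and let $\mathfrak{m}_{\mathbf{C}_p} = \{z \in \mathbf{C}_p : |z| < 1\}$ be the open unit disk. Then the set of power series $f(X) \in \mathcal{O}_K[[X]]$ that have only simple roots in $\mathfrak{m}_{\mathbf{C}_p}$ (that is, such that there is no $z \in \mathfrak{m}_{\mathbf{C}_p}$ with $f(z) = f'(z) = 0$) is open in $\mathcal{O}_K[[X]]$ for the $p$-adic topology (the topology for which the sets $f + p^n \mathcal{O}_K[[X]]$, $n \geq 0$, form a basis of neighbourhoods of $f$). -/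

import Mathlib

noncomputable section

namespace PadicPowerSeries

open IsDedekindDomain

section WittBase

variable (p : ℕ) [Fact p.Prime] (k : Type*) [Field k] [CharP k p] [PerfectRing k p]

/-- The maximal ideal of the discrete valuation ring `W(k)`, as a prime of height one. -/
def wittPrime : HeightOneSpectrum (WittVector p k) :=
  IsDiscreteValuationRing.maximalIdeal (WittVector p k)

lemma one_lt_p : (1 : NNReal) < (p : NNReal) := by
  exact_mod_cast (Fact.out : p.Prime).one_lt

/-- The `p`-adic absolute value on `W(k)[1/p] = Frac W(k)`, normalised by `|p| = 1/p`. -/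
def wittAbv : AbsoluteValue (FractionRing (WittVector p k)) ℝ :=
  (wittPrime p k).adicAbv (one_lt_p p)

lemma wittAbv_algebraMap_le_one (x : WittVector p k) :
    wittAbv p k (algebraMap (WittVector p k) (FractionRing (WittVector p k)) x) ≤ 1 :=
  HeightOneSpectrum.adicAbv_coe_le_one _ _ _

lemma wittPrime_asIdeal : (wittPrime p k).asIdeal = Ideal.span {(p : WittVector p k)} :=
  (WittVector.irreducible p).maximalIdeal_eq

lemma wittAbv_p : wittAbv p k (p : FractionRing (WittVector p k)) = (p : ℝ)⁻¹ := by
  have h : (wittPrime p k).valuation (FractionRing (WittVector p k))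
      (algebraMap (WittVector p k) _ (p : WittVector p k)) = WithZero.exp (-1 : ℤ) := by
    rw [HeightOneSpectrum.valuation_of_algebraMap]
    exact HeightOneSpectrum.intValuation_singleton _ (WittVector.irreducible p).ne_zero
      (wittPrime_asIdeal p k)
  rw [map_natCast] at h
  have h2 : wittAbv p k (p : FractionRing (WittVector p k)) =
    ((WithZeroMulInt.toNNReal (ne_zero_of_lt (one_lt_p p))
      ((wittPrime p k).valuation (FractionRing (WittVector p k)) p) : NNReal) : ℝ) := rfl
  have h3 : WithZeroMulInt.toNNReal (ne_zero_of_lt (one_lt_p p)) (WithZero.exp (-1 : ℤ)) =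
      (p : NNReal) ^ (-1 : ℤ) := WithZeroMulInt.toNNReal_neg_apply _ WithZero.exp_ne_zero
  rw [h2, h, h3]
  simp

/-- An element of `W(k)[1/p]` of absolute value at most `1` lies in `W(k)`. -/
lemma exists_of_wittAbv_le_one (x : FractionRing (WittVector p k)) (hx : wittAbv p k x ≤ 1) :
    ∃ w : WittVector p k, algebraMap (WittVector p k) _ w = x := by
  have h : (wittPrime p k).valuation (FractionRing (WittVector p k)) x ≤ 1 := by
    rw [← (WithZeroMulInt.toNNReal_strictMono (one_lt_p p)).le_iff_le, map_one]
    exact NNReal.coe_le_coe.mp hx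
  exact IsDiscreteValuationRing.exists_lift_of_le_one h

/-- `W(k)[1/p]` as a normed field for the `p`-adic absolute value. -/
instance wittNontriviallyNormedField :
    NontriviallyNormedField (FractionRing (WittVector p k)) where
  __ := (wittAbv p k).toNormedField
  non_trivial := by
    refine ⟨(p : FractionRing (WittVector p k))⁻¹, ?_⟩
    change 1 < wittAbv p k _
    rw [map_inv₀, wittAbv_p, inv_inv]
    exact_mod_cast (Fact.out : p.Prime).one_lt

lemma norm_def (x : FractionRing (WittVector p k)) : ‖x‖ = wittAbv p k x := rfl

instance wittIsUltrametricDist : IsUltrametricDist (FractionRing (WittVector p k)) :=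
  IsUltrametricDist.isUltrametricDist_of_forall_norm_add_le_max_norm
    (HeightOneSpectrum.isNonarchimedean_adicAbv (wittPrime p k) (one_lt_p p))

instance wittCompleteSpace : CompleteSpace (FractionRing (WittVector p k)) := by
  have hp0 : (0 : ℝ) < p := by exact_mod_cast (Fact.out : p.Prime).pos
  have hpF (N : ℕ) : ‖(p : FractionRing (WittVector p k)) ^ N‖ = ((p : ℝ) ^ N)⁻¹ := by
    rw [norm_pow, norm_def, wittAbv_p, inv_pow]
  have hp1 (N : ℕ) : (p : FractionRing (WittVector p k)) ^ N ≠ 0 := by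
    rw [← norm_pos_iff, hpF]
    positivity
  refine Metric.complete_of_convergent_controlled_sequences (fun N : ℕ => ((p : ℝ) ^ N)⁻¹)
    (fun N => by positivity) fun u hu => ?_
  have h0 (n : ℕ) : ∃ w : WittVector p k, algebraMap (WittVector p k) _ w = u n - u 0 := by
    refine exists_of_wittAbv_le_one p k _ ?_
    have := (hu 0 n 0 (Nat.zero_le _) le_rfl).le
    rwa [dist_eq_norm, norm_def, pow_zero, inv_one] at this
  choose w hw using h0
  have hmem {m n : ℕ} (hmn : m ≤ n) : ∃ y, w m - w n = (p : WittVector p k) ^ m * y := by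
    obtain ⟨y, hy⟩ := exists_of_wittAbv_le_one p k ((u m - u n) / (p : FractionRing _) ^ m) (by
      rw [← norm_def, norm_div, hpF, ← dist_eq_norm]
      exact div_le_one_of_le₀ (hu m m n le_rfl hmn).le (by positivity))
    refine ⟨y, IsFractionRing.injective (WittVector p k) (FractionRing (WittVector p k)) ?_⟩
    rw [map_sub, hw, hw, map_mul, hy, map_pow, map_natCast, mul_div_cancel₀ _ (hp1 m)]
    ring
  have hW : IsAdicComplete (Ideal.span {(p : WittVector p k)}) (WittVector p k) := inferInstance
  obtain ⟨L, hL⟩ := hW.toIsPrecomplete.prec (f := w) (fun {m n} hmn => by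
    obtain ⟨y, hy⟩ := hmem hmn
    rw [SModEq.sub_mem, hy, Ideal.span_singleton_pow, smul_eq_mul, Ideal.mul_top]
    exact Ideal.mul_mem_right _ _ (Ideal.mem_span_singleton_self _))
  refine ⟨algebraMap _ _ L + u 0, ?_⟩
  rw [tendsto_iff_dist_tendsto_zero]
  refine squeeze_zero (fun _ => dist_nonneg) (g := fun n : ℕ => ((p : ℝ)⁻¹) ^ n) (fun n => ?_)
    (tendsto_pow_atTop_nhds_zero_of_lt_one (by positivity)
      (inv_lt_one_of_one_lt₀ (by exact_mod_cast (Fact.out : p.Prime).one_lt)))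
  have h := hL n
  rw [SModEq.sub_mem, Ideal.span_singleton_pow, smul_eq_mul, Ideal.mul_top,
    Ideal.mem_span_singleton] at h
  obtain ⟨y, hy⟩ := h
  have e : u n - (algebraMap _ _ L + u 0) =
      (p : FractionRing (WittVector p k)) ^ n * algebraMap _ _ y := by
    rw [← map_natCast (algebraMap (WittVector p k) (FractionRing (WittVector p k))), ← map_pow,
      ← map_mul, ← hy, map_sub, hw]
    ring
  rw [dist_eq_norm, e, norm_mul, hpF, inv_pow]
  exact mul_le_of_le_one_right (by positivity) (wittAbv_algebraMap_le_one p k y)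

end WittBase

section Cp

variable (p : ℕ) [Fact p.Prime] (k : Type*) [Field k] [CharP k p] [PerfectRing k p]
  (K : Type*) [Field K] [Algebra (FractionRing (WittVector p k)) K]

/-- An algebraic closure of `K`, to be normed by the extension of the `p`-adic absolute value of
`W(k)[1/p]`. -/
@[nolint unusedArguments]
def AlgCl (p : ℕ) [Fact p.Prime] (k : Type*) [Field k] [CharP k p] [PerfectRing k p]
    (K : Type*) [Field K] [Algebra (FractionRing (WittVector p k)) K] : Type _ :=
  AlgebraicClosure K

instance : Field (AlgCl p k K) := inferInstanceAs (Field (AlgebraicClosure K))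

instance : Algebra K (AlgCl p k K) := inferInstanceAs (Algebra K (AlgebraicClosure K))

instance : Algebra (FractionRing (WittVector p k)) (AlgCl p k K) :=
  inferInstanceAs (Algebra (FractionRing (WittVector p k)) (AlgebraicClosure K))

instance : IsScalarTower (FractionRing (WittVector p k)) K (AlgCl p k K) :=
  inferInstanceAs (IsScalarTower (FractionRing (WittVector p k)) K (AlgebraicClosure K))

instance : IsAlgClosure K (AlgCl p k K) :=
  inferInstanceAs (IsAlgClosure K (AlgebraicClosure K))

variable [FiniteDimensional (FractionRing (WittVector p k)) K]

instance : Algebra.IsAlgebraic (FractionRing (WittVector p k)) (AlgCl p k K) :=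
  haveI : Algebra.IsAlgebraic K (AlgCl p k K) := IsAlgClosure.isAlgebraic
  Algebra.IsAlgebraic.trans (FractionRing (WittVector p k)) K (AlgCl p k K)

/-- The norm on the algebraic closure of `K` is the spectral norm over `W(k)[1/p]`, that is, the
unique absolute value that extends the `p`-adic one. -/
instance : NormedField (AlgCl p k K) :=
  spectralNorm.normedField (FractionRing (WittVector p k)) (AlgCl p k K)

/-- The field `C_p`: the completion of the algebraic closure of `K`. -/
abbrev Cp : Type _ := UniformSpace.Completion (AlgCl p k K)

/-- The embedding of `K` into `C_p`. -/
def toCp : K →+* Cp p k K :=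
  UniformSpace.Completion.coeRingHom.comp (algebraMap K (AlgCl p k K))

/-- The integers `O_K` of `K`: the elements integral over `W(k)`. -/
abbrev ringOfIntegers [Algebra (WittVector p k) K] : Subalgebra (WittVector p k) K :=
  integralClosure (WittVector p k) K

variable {K} [Algebra (WittVector p k) K]

/-- The value `f(z) = ∑ fₙ zⁿ` of a power series over `O_K` at a point of `C_p`; the sum converges
when `‖z‖ < 1`. -/
def evalCp (f : PowerSeries (ringOfIntegers p k K)) (z : Cp p k K) : Cp p k K :=
  ∑' n : ℕ, toCp p k K (algebraMap (ringOfIntegers p k K) K (PowerSeries.coeff n f)) * z ^ n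

/-- All roots of `f` in the open unit disk of `C_p` are simple: `f` and `f'` have no common root
there. -/
def HasOnlySimpleRoots (f : PowerSeries (ringOfIntegers p k K)) : Prop :=
  ∀ z : Cp p k K, ‖z‖ < 1 → evalCp p k f z = 0 →
    evalCp p k (PowerSeries.derivative (ringOfIntegers p k K) f) z ≠ 0

end Cp

end PadicPowerSeries

end

noncomputable section

namespace PadicPowerSeries

/-! The simple-root condition is algebraic: it holds exactly when some `p ^ n` lies in the ideal
`(f, f')` (`hasOnlySimpleRoots_iff`). If `a f + b f' = p ^ n`, the same `a` and `b` applied to `f +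
p ^ (n + 1) h` give `p ^ n` times the unit `1 + p (a h + b h')`, so the condition persists on a
whole neighbourhood.

To find `n`, Weierstrass preparation over the complete discrete valuation ring `O_K` gives `f = c P
u` with `P` distinguished and `u` a unit. All roots of `P` lie in the open disk
(`norm_lt_one_of_eval₂_eq_zero`), so simplicity makes `P` separable over `K`. A Bézout relation for
`P` and `P'`, cleared of denominators, puts a nonzero constant in `(f, f')`
(`exists_C_mem_span_pair_derivative`), and that constant divides a power of `p`. -/

/-! ### Weierstrass preparation and Bézout relations -/

open Polynomial in
/-- Over a complete discretely valued ring every nonzero power series is a constant times a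
distinguished polynomial times a unit. -/
lemma exists_eq_C_mul_distinguished_mul_unit {O : Type*} [CommRing O] [IsDomain O]
    [IsDiscreteValuationRing O] [IsAdicComplete (IsLocalRing.maximalIdeal O) O]
    {f : PowerSeries O} (hf : f ≠ 0) :
    ∃ (c : O) (P : O[X]) (u : PowerSeries O), c ≠ 0 ∧
      P.IsDistinguishedAt (IsLocalRing.maximalIdeal O) ∧ IsUnit u ∧
      f = PowerSeries.C c * ((P : PowerSeries O) * u) := by
  classical
  -- A coefficient of minimal valuation divides all the others; dividing by it leaves a series with
  -- a coefficient `1`, hence nonzero modulo the maximal ideal.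
  have hS : (Set.range fun n => IsDiscreteValuationRing.addVal O (f.coeff n)).Nonempty :=
    Set.range_nonempty _
  obtain ⟨i, hi⟩ := WellFounded.min_mem (wellFounded_lt (α := ℕ∞)) _ hS
  have hmin (n : ℕ) : f.coeff i ∣ f.coeff n := by
    rw [← IsDiscreteValuationRing.addVal_le_iff_dvd]
    have := WellFounded.min_le (wellFounded_lt (α := ℕ∞)) (s := Set.range fun n =>
      IsDiscreteValuationRing.addVal O (f.coeff n)) ⟨n, rfl⟩
    exact hi.le.trans this
  have hc : f.coeff i ≠ 0 := fun h => hf <| PowerSeries.ext fun n => by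
    simpa [h] using hmin n
  choose a ha using hmin
  have hai : a i = 1 := by
    have := ha i
    exact (mul_left_cancel₀ hc (by rw [mul_one]; exact this)).symm
  have hg : (PowerSeries.mk a).map (IsLocalRing.residue O) ≠ 0 := fun h => by
    have := congrArg (PowerSeries.coeff i) h
    simp [hai] at this
  obtain ⟨P, u, h⟩ := PowerSeries.exists_isWeierstrassFactorization hg
  refine ⟨f.coeff i, P, u, hc, h.isDistinguishedAt, h.isUnit, ?_⟩
  rw [← h.eq_mul]
  ext n
  simpa using ha n

open Polynomial in
/-- If `P` is separable over the fraction field, then the ideal generated by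
`f = c P u` and its derivative contains a nonzero constant. -/
lemma exists_C_mem_span_pair_derivative {O L : Type*} [CommRing O] [IsDomain O] [Field L]
    [Algebra O L] [IsFractionRing O L] {f u : PowerSeries O} {c : O} {P : O[X]} (hc : c ≠ 0)
    (hu : IsUnit u) (hf : f = PowerSeries.C c * ((P : PowerSeries O) * u))
    (hP : (P.map (algebraMap O L)).Separable) :
    ∃ d : O, d ≠ 0 ∧ PowerSeries.C d ∈ Ideal.span {f, PowerSeries.derivative O f} := by
  obtain ⟨a, b, hab⟩ := hP
  obtain ⟨s, hs, hsa⟩ := IsLocalization.integerNormalization_spec (nonZeroDivisors O) a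
  obtain ⟨t, ht, htb⟩ := IsLocalization.integerNormalization_spec (nonZeroDivisors O) b
  set A := IsLocalization.integerNormalization (nonZeroDivisors O) a
  set B := IsLocalization.integerNormalization (nonZeroDivisors O) b
  -- Bézout over `L`, multiplied by both denominators `s` and `t`.
  have key : C t * A * P + C s * B * Polynomial.derivative P = C (s * t) := by
    apply Polynomial.map_injective _ (IsFractionRing.injective O L)
    rw [Polynomial.derivative_map] at hab
    simp only [Polynomial.map_add, Polynomial.map_mul, Polynomial.map_C, hsa, htb,
      Algebra.smul_def, Polynomial.algebraMap_apply, map_mul]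
    linear_combination (C (algebraMap O L s) * C (algebraMap O L t)) * hab
  obtain ⟨v, hv⟩ := hu.exists_right_inv
  have hf' : PowerSeries.derivative O f = PowerSeries.C c *
      ((P : PowerSeries O) * PowerSeries.derivative O u +
        (Polynomial.derivative P : O[X]) * u) := by
    rw [hf, Derivation.leibniz, Derivation.leibniz, PowerSeries.derivative_C,
      PowerSeries.derivative_coe]
    simp only [smul_eq_mul]
    ring
  have key' := congrArg (fun q : O[X] => (q : PowerSeries O)) key
  simp only [Polynomial.coe_add, Polynomial.coe_mul, Polynomial.coe_C] at key'
  -- With `v = u⁻¹`, one has `c P = v f` and `c P' = v f' - v² u' f`; substitute these into `c`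
  -- times `key`.
  refine ⟨c * (s * t), mul_ne_zero hc (mul_ne_zero (nonZeroDivisors.ne_zero hs)
    (nonZeroDivisors.ne_zero ht)), Ideal.mem_span_pair.2
    ⟨PowerSeries.C t * A * v -
      PowerSeries.C s * B * v * v * PowerSeries.derivative O u, PowerSeries.C s * B * v, ?_⟩⟩
  rw [map_mul, ← key', hf', hf]
  linear_combination (PowerSeries.C c * PowerSeries.C t * A * P -
    PowerSeries.C c * PowerSeries.C s * B * P * v * PowerSeries.derivative O u
    + PowerSeries.C c * PowerSeries.C s * B * (Polynomial.derivative P : O[X])) * hv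

/-! ### Adic completeness -/

/-- A finite free algebra over a `p`-adically complete ring is `p`-adically complete. -/
lemma isAdicComplete_span_of_free {R S : Type*} [CommRing R] [CommRing S] [Algebra R S]
    [Module.Finite R S] [Module.Free R S] (a : R) [IsAdicComplete (Ideal.span {a}) R] :
    IsAdicComplete (Ideal.span {algebraMap R S a}) S := by
  -- Congruence modulo `a ^ n` can be tested on coordinates, so limits are taken coordinatewise.
  let b := Module.Free.chooseBasis R S
  have hmem (n : ℕ) (x y : S) :
      x ≡ y [SMOD (Ideal.span {algebraMap R S a} ^ n • ⊤ : Submodule S S)] ↔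
      ∀ i, b.repr x i ≡ b.repr y i [SMOD (Ideal.span {a} ^ n • ⊤ : Submodule R R)] := by
    simp only [SModEq.sub_mem, Ideal.span_singleton_pow, smul_eq_mul, Ideal.mul_top,
      Ideal.mem_span_singleton]
    constructor
    · rintro ⟨z, hz⟩ i
      rw [← map_pow, ← Algebra.smul_def] at hz
      refine ⟨b.repr z i, ?_⟩
      have := congrArg (fun w => b.repr w i) hz
      simpa using this
    · intro h
      choose z hz using h
      refine ⟨∑ i, z i • b i, ?_⟩
      rw [← map_pow, ← Algebra.smul_def, Finset.smul_sum, ← b.sum_repr (x - y)]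
      refine Finset.sum_congr rfl fun i _ => ?_
      rw [smul_smul, ← hz i, map_sub, Finsupp.sub_apply]
  refine { haus' := fun x hx => ?_, prec' := fun f hf => ?_ }
  · apply b.repr.injective
    ext i
    rw [map_zero, Finsupp.zero_apply]
    refine IsHausdorff.haus (I := Ideal.span {a}) inferInstance _ fun n => ?_
    simpa using (hmem n x 0).1 (hx n) i
  · have h (i) := IsPrecomplete.prec (I := Ideal.span {a}) inferInstance
      (f := fun n => b.repr (f n) i) (fun {m n} hmn => (hmem m _ _).1 (hf hmn) i)
    choose L hL using h
    refine ⟨∑ i, L i • b i, fun n => (hmem n _ _).2 fun i => ?_⟩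
    rw [b.repr_sum_self]
    exact hL i n

/-- Completeness for a positive power of an ideal implies completeness for the ideal. -/
lemma isAdicComplete_of_pow {R : Type*} [CommRing R] (I : Ideal R) {n : ℕ} (hn : 0 < n)
    [h : IsAdicComplete (I ^ n) R] : IsAdicComplete I R := by
  -- Adic completeness depends only on the topology, which is the same for `I` and `I ^ n`.
  let _ : WithIdeal R := ⟨I⟩
  have h1 : IsAdic I := rfl
  rw [h1.isAdicComplete_iff, ← (is_ideal_adic_pow h1 hn).isAdicComplete_iff]
  exact h

/-! ### Evaluation on the open unit disk -/

/-- The value at `z`, with `‖z‖ < 1`, of power series with coefficients mapped into the unit ball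
of a complete normed field, as a ring homomorphism. -/
def evalOfNormLtOne {R E : Type*} [CommRing R] [NormedField E] [CompleteSpace E] (φ : R →+* E)
    (hφ : ∀ r, ‖φ r‖ ≤ 1) (z : E) (hz : ‖z‖ < 1) : PowerSeries R →+* E :=
  have hs (f : PowerSeries R) : Summable fun n => ‖φ (f.coeff n) * z ^ n‖ :=
    Summable.of_nonneg_of_le (fun _ => norm_nonneg _)
      (fun n => by
        rw [norm_mul, norm_pow]
        exact mul_le_of_le_one_left (by positivity) (hφ _))
      (summable_geometric_of_lt_one (norm_nonneg z) hz)
  { toFun := fun f => ∑' n, φ (f.coeff n) * z ^ n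
    map_one' := by
      rw [tsum_eq_single 0 fun n hn => by rw [PowerSeries.coeff_one, if_neg hn]; simp]
      simp
    map_zero' := by simp
    map_add' := fun f g => by
      rw [← (hs f).of_norm.tsum_add (hs g).of_norm]
      simp [add_mul]
    map_mul' := fun f g => by
      rw [tsum_mul_tsum_eq_tsum_sum_antidiagonal_of_summable_norm (hs f) (hs g)]
      refine tsum_congr fun n => ?_
      rw [PowerSeries.coeff_mul, map_sum, Finset.sum_mul]
      refine Finset.sum_congr rfl fun ij hij => ?_
      rw [← Finset.HasAntidiagonal.mem_antidiagonal.1 hij, map_mul, pow_add]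
      ring }

lemma evalOfNormLtOne_coe {R E : Type*} [CommRing R] [NormedField E] [CompleteSpace E]
    (φ : R →+* E) (hφ : ∀ r, ‖φ r‖ ≤ 1) (z : E) (hz : ‖z‖ < 1) (P : Polynomial R) :
    evalOfNormLtOne φ hφ z hz P = P.eval₂ φ z := by
  change ∑' n, φ ((P : PowerSeries R).coeff n) * z ^ n = _
  rw [Polynomial.eval₂_eq_sum_range, tsum_eq_sum (s := Finset.range (P.natDegree + 1)) fun n hn => ?_]
  · simp
  · rw [Polynomial.coeff_coe, Polynomial.coeff_eq_zero_of_natDegree_lt (by simpa using hn),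
      map_zero, zero_mul]

/-- The roots of a monic polynomial whose other coefficients lie in the open unit ball lie in the
open unit ball. -/
lemma norm_lt_one_of_eval₂_eq_zero {R E : Type*} [CommRing R] [NormedField E]
    [IsUltrametricDist E] (φ : R →+* E) (P : Polynomial R) (hP : P.Monic)
    (hlt : ∀ n < P.natDegree, ‖φ (P.coeff n)‖ < 1) {x : E} (hx : P.eval₂ φ x = 0) : ‖x‖ < 1 := by
  by_contra! h
  rw [Polynomial.eval₂_eq_sum_range, Finset.sum_range_succ, hP.coeff_natDegree, map_one, one_mul,
    add_eq_zero_iff_neg_eq] at hx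
  have hpos : 0 < ‖x‖ ^ P.natDegree := by positivity
  -- If `‖x‖ ≥ 1`, the leading term strictly dominates all the others and cannot cancel.
  have h2 : ‖∑ n ∈ Finset.range P.natDegree, φ (P.coeff n) * x ^ n‖ < ‖x‖ ^ P.natDegree := by
    rcases (Finset.range P.natDegree).eq_empty_or_nonempty with he | hne
    · rwa [he, Finset.sum_empty, norm_zero]
    obtain ⟨n, hn, hle⟩ := IsUltrametricDist.exists_norm_finsetSum_le_of_nonempty hne
      fun n => φ (P.coeff n) * x ^ n
    refine hle.trans_lt ?_
    rw [norm_mul, norm_pow]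
    have hn := Finset.mem_range.1 hn
    calc _ < 1 * ‖x‖ ^ n := by
          have : 0 < ‖x‖ ^ n := by positivity
          gcongr
          exact hlt n hn
      _ ≤ ‖x‖ ^ P.natDegree := by rw [one_mul]; exact pow_le_pow_right₀ h hn.le
  rw [← norm_pow, ← hx, norm_neg] at h2
  exact lt_irrefl _ h2

/-! ### `O_K` as a complete discrete valuation ring -/

section

variable (p : ℕ) [Fact p.Prime] (k : Type*) [Field k] [CharP k p] [PerfectRing k p]

/-- A prime characteristic `q` would vanish in `k`, forcing `q = p`, yet `|p| = 1/p` is nonzero.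
This makes `K` separable, whence the finiteness of `O_K` over `W(k)`. -/
lemma charZero_fractionRing_wittVector : CharZero (FractionRing (WittVector p k)) := by
  obtain ⟨q, hq⟩ := CharP.exists (FractionRing (WittVector p k))
  rcases CharP.char_is_prime_or_zero (FractionRing (WittVector p k)) q with h | rfl
  · exfalso
    have h0 : (q : WittVector p k) = 0 := by
      apply IsFractionRing.injective (WittVector p k) (FractionRing (WittVector p k))
      simp
    have h1 : (q : k) = 0 := by
      simpa using congrArg (WittVector.constantCoeff (p := p)) h0
    have h2 := (Nat.prime_dvd_prime_iff_eq Fact.out h).1 ((CharP.cast_eq_zero_iff k p q).1 h1)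
    have h3 := wittAbv_p p k
    have h4 : (p : FractionRing (WittVector p k)) = 0 := by
      rw [CharP.cast_eq_zero_iff (FractionRing (WittVector p k)) q, h2]
    rw [h4, map_zero] at h3
    have : (p : ℝ)⁻¹ ≠ 0 := inv_ne_zero (by exact_mod_cast (Fact.out : p.Prime).ne_zero)
    exact this h3.symm
  · exact CharP.charP_to_charZero _

variable (K : Type*) [Field K]
    [Algebra (FractionRing (WittVector p k)) K]
    [FiniteDimensional (FractionRing (WittVector p k)) K]
    [Algebra (WittVector p k) K]
    [IsScalarTower (WittVector p k) (FractionRing (WittVector p k)) K]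

local notation "𝓞" => ringOfIntegers p k K

omit [Algebra (WittVector p k) K]
  [IsScalarTower (WittVector p k) (FractionRing (WittVector p k)) K] in
lemma norm_algebraMap_alg (x : FractionRing (WittVector p k)) :
    ‖algebraMap (FractionRing (WittVector p k)) (AlgCl p k K) x‖ = ‖x‖ :=
  spectralNorm_extends x

instance : IsUltrametricDist (AlgCl p k K) :=
  IsUltrametricDist.isUltrametricDist_of_forall_norm_add_le_max_norm
    (isNonarchimedean_spectralNorm (K := FractionRing (WittVector p k)))

variable {K} in
/-- The integers of `K` are the elements of absolute value at most `1`. -/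
lemma mem_ringOfIntegers_iff (x : K) :
    x ∈ 𝓞 ↔ ‖algebraMap K (AlgCl p k K) x‖ ≤ 1 := by
  have hx : IsIntegral (FractionRing (WittVector p k)) x := Algebra.IsIntegral.isIntegral x
  have e : ‖algebraMap K (AlgCl p k K) x‖ =
      spectralValue (minpoly (FractionRing (WittVector p k)) x) := by
    exact (spectralNorm.eq_of_tower (K := FractionRing (WittVector p k)) (L := AlgCl p k K) x).symm
  -- Norm at most `1` now means that the minimal polynomial has coefficients in `W(k)`; for integral
  -- `x` this holds because `W(k)` is integrally closed.
  rw [e, spectralValue_le_one_iff (minpoly.monic hx), mem_integralClosure_iff]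
  constructor
  · intro h n
    rw [minpoly.isIntegrallyClosed_eq_field_fractions' (FractionRing (WittVector p k)) h,
      Polynomial.coeff_map]
    exact wittAbv_algebraMap_le_one p k _
  · intro h
    have hl : minpoly (FractionRing (WittVector p k)) x ∈
        Polynomial.lifts (algebraMap (WittVector p k) (FractionRing (WittVector p k))) := by
      rw [Polynomial.lifts_iff_coeff_lifts]
      exact fun n => exists_of_wittAbv_le_one p k _ (h n)
    obtain ⟨q, hq, -, hm⟩ := Polynomial.lifts_and_natDegree_eq_and_monic hl (minpoly.monic hx)
    refine ⟨q, hm, ?_⟩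
    have := minpoly.aeval (FractionRing (WittVector p k)) x
    rw [← hq, Polynomial.aeval_map_algebraMap] at this
    exact this

instance : IsFractionRing 𝓞 K :=
  integralClosure.isFractionRing_of_finite_extension (FractionRing (WittVector p k)) K

instance : Algebra.IsSeparable (FractionRing (WittVector p k)) K :=
  haveI := charZero_fractionRing_wittVector p k
  inferInstance

instance : Module.Finite (WittVector p k) 𝓞 :=
  IsIntegralClosure.finite (WittVector p k) (FractionRing (WittVector p k)) K 𝓞

instance : IsDedekindDomain 𝓞 :=
  integralClosure.isDedekindDomain (WittVector p k) (FractionRing (WittVector p k)) K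

variable {K} in
lemma isUnit_ringOfIntegers_iff (x : 𝓞) :
    IsUnit x ↔ ‖algebraMap K (AlgCl p k K) x‖ = 1 := by
  constructor
  · rintro ⟨u, rfl⟩
    have h1 := (mem_ringOfIntegers_iff p k _).1 (u : 𝓞).2
    have h2 := (mem_ringOfIntegers_iff p k _).1 ((u⁻¹ : 𝓞ˣ) : 𝓞).2
    have h3 : ((u : 𝓞) : K) * ((u⁻¹ : 𝓞ˣ) : 𝓞) = 1 := by
      exact_mod_cast congrArg (Subtype.val) u.mul_inv
    have h4 := congrArg (fun y => ‖algebraMap K (AlgCl p k K) y‖) h3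
    simp only [map_mul, norm_mul, map_one, norm_one] at h4
    exact le_antisymm h1 (by rw [← h4]; exact mul_le_of_le_one_right (norm_nonneg _) h2)
  · intro h
    have h0 : (x : K) ≠ 0 := fun h0 => by simp [h0] at h
    refine IsUnit.of_mul_eq_one ⟨(x : K)⁻¹, (mem_ringOfIntegers_iff p k _).2 ?_⟩
      (Subtype.ext (mul_inv_cancel₀ h0))
    rw [map_inv₀, norm_inv, h, inv_one]

variable {K} in
lemma not_isUnit_ringOfIntegers_iff (x : 𝓞) :
    ¬ IsUnit x ↔ ‖algebraMap K (AlgCl p k K) x‖ < 1 := by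
  rw [isUnit_ringOfIntegers_iff, ((mem_ringOfIntegers_iff p k _).1 x.2).lt_iff_ne]

instance : IsLocalRing 𝓞 :=
  IsLocalRing.of_nonunits_add fun a b ha hb => by
    rw [mem_nonunits_iff, not_isUnit_ringOfIntegers_iff] at *
    rw [Subalgebra.coe_add, map_add]
    exact (IsUltrametricDist.norm_add_le_max _ _).trans_lt (max_lt ha hb)

omit [IsScalarTower (WittVector p k) (FractionRing (WittVector p k)) K] in
lemma norm_p_ringOfIntegers :
    ‖algebraMap K (AlgCl p k K) ((p : 𝓞) : K)‖ = (p : ℝ)⁻¹ := by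
  rw [← wittAbv_p p k, ← norm_def, ← norm_algebraMap_alg p k K]
  simp

omit [IsScalarTower (WittVector p k) (FractionRing (WittVector p k)) K] in
lemma norm_p_pow (n : ℕ) : ‖algebraMap K (AlgCl p k K) (((p : 𝓞) ^ n : 𝓞) : K)‖ =
    ((p : ℝ)⁻¹) ^ n := by
  rw [← norm_p_ringOfIntegers p k K, SubmonoidClass.coe_pow, map_pow, norm_pow]

lemma p_inv_lt_one : (p : ℝ)⁻¹ < 1 :=
  inv_lt_one_of_one_lt₀ (by exact_mod_cast (Fact.out : p.Prime).one_lt)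

lemma p_mem_maximalIdeal : (p : 𝓞) ∈ IsLocalRing.maximalIdeal 𝓞 := by
  rw [IsLocalRing.mem_maximalIdeal, mem_nonunits_iff, not_isUnit_ringOfIntegers_iff,
    norm_p_ringOfIntegers]
  exact p_inv_lt_one p

omit [IsScalarTower (WittVector p k) (FractionRing (WittVector p k)) K] in
lemma p_ne_zero_ringOfIntegers : (p : 𝓞) ≠ 0 := fun h => by
  have := norm_p_ringOfIntegers p k K
  rw [h] at this
  have h0 : (p : ℝ)⁻¹ ≠ 0 := inv_ne_zero (by exact_mod_cast (Fact.out : p.Prime).ne_zero)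
  exact h0 (by simpa using this.symm)

/-- A local Dedekind domain qualifies once it is not a field, and `p` is a nonzero nonunit. -/
instance : IsDiscreteValuationRing 𝓞 := by
  have hF : ¬ IsField 𝓞 := fun h => by
    have := (IsLocalRing.isField_iff_maximalIdeal_eq.1 h) ▸ p_mem_maximalIdeal p k K
    exact p_ne_zero_ringOfIntegers p k K (by simpa using this)
  exact ((IsDiscreteValuationRing.TFAE 𝓞 hF).out 2 0).1
    (inferInstance : IsDedekindDomain 𝓞)

variable {K} in
/-- Every nonzero integer of `K` divides a power of `p`. -/
lemma exists_dvd_p_pow {d : 𝓞} (hd : d ≠ 0) : ∃ n : ℕ, d ∣ (p : 𝓞) ^ n := by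
  have hd' : (d : K) ≠ 0 := by simpa using hd
  have hpos : 0 < ‖algebraMap K (AlgCl p k K) d‖ := by simpa using hd'
  obtain ⟨n, hn⟩ := exists_pow_lt_of_lt_one hpos (p_inv_lt_one p)
  refine ⟨n, ⟨(((p : 𝓞) ^ n : 𝓞) : K) / d, (mem_ringOfIntegers_iff p k _).2 ?_⟩, ?_⟩
  · rw [map_div₀, norm_div, norm_p_pow]
    exact div_le_one_of_le₀ hn.le hpos.le
  · apply Subtype.ext
    rw [Subalgebra.coe_mul, mul_div_cancel₀ _ hd']

/-- Used to see that `O_K`, finite and torsion-free over `W(k)`, is free. -/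
instance : Module.IsTorsionFree (WittVector p k) K := by
  have : FaithfulSMul (WittVector p k) K := by
    rw [faithfulSMul_iff_algebraMap_injective,
      IsScalarTower.algebraMap_eq (WittVector p k) (FractionRing (WittVector p k)) K]
    exact (algebraMap (FractionRing (WittVector p k)) K).injective.comp
      (IsFractionRing.injective _ _)
  infer_instance

/-- Freeness transfers `p`-adic completeness from `W(k)`, and `(p)` is a positive power of the
maximal ideal. -/
instance : IsAdicComplete (IsLocalRing.maximalIdeal 𝓞) 𝓞 := by
  have h : IsAdicComplete (Ideal.span {(p : 𝓞)}) 𝓞 := by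
    simpa using isAdicComplete_span_of_free (S := 𝓞) (p : WittVector p k)
  obtain ⟨ϖ, hϖ⟩ := IsDiscreteValuationRing.exists_irreducible 𝓞
  obtain ⟨n, hn⟩ := IsDiscreteValuationRing.ideal_eq_span_pow_irreducible
    (s := Ideal.span {(p : 𝓞)}) (by simpa using p_ne_zero_ringOfIntegers p k K) hϖ
  have hn0 : n ≠ 0 := by
    rintro rfl
    have h1 : Ideal.span {(p : 𝓞)} ≤ IsLocalRing.maximalIdeal 𝓞 := by
      simpa [Ideal.span_le] using p_mem_maximalIdeal p k K
    rw [hn] at h1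
    exact (IsLocalRing.maximalIdeal.isMaximal 𝓞).ne_top (by simpa using h1)
  rw [hn, ← Ideal.span_singleton_pow, ← hϖ.maximalIdeal_eq] at h
  exact isAdicComplete_of_pow _ (Nat.pos_of_ne_zero hn0)

/-! ### The ideal-theoretic criterion and openness -/

/-- The embedding of `O_K` into `C_p`. -/
def integersToCp : 𝓞 →+* Cp p k K :=
  (toCp p k K).comp (algebraMap 𝓞 K)

variable {K}

omit [IsScalarTower (WittVector p k) (FractionRing (WittVector p k)) K] in
lemma norm_integersToCp (x : 𝓞) :
    ‖integersToCp p k K x‖ = ‖algebraMap K (AlgCl p k K) (x : K)‖ :=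
  UniformSpace.Completion.norm_coe _

/-- Evaluation at a point of the open unit disk of `C_p` as a ring homomorphism. -/
def evalCpHom (z : Cp p k K) (hz : ‖z‖ < 1) : PowerSeries 𝓞 →+* Cp p k K :=
  evalOfNormLtOne (integersToCp p k K)
    (fun x => (norm_integersToCp p k x).trans_le ((mem_ringOfIntegers_iff p k _).1 x.2)) z hz

lemma evalCpHom_apply (z : Cp p k K) (hz : ‖z‖ < 1) (f : PowerSeries 𝓞) :
    evalCpHom p k z hz f = evalCp p k f z := rfl

lemma hasOnlySimpleRoots_iff (f : PowerSeries 𝓞) :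
    HasOnlySimpleRoots p k f ↔
      ∃ n : ℕ, (p : PowerSeries 𝓞) ^ n ∈ Ideal.span {f, PowerSeries.derivative 𝓞 f} := by
  constructor
  · intro h
    have hf : f ≠ 0 := by
      rintro rfl
      refine h 0 (by simp) ?_ ?_ <;> simp [evalCp]
    obtain ⟨c, P, u, hc, hP, hu, hfP⟩ := exists_eq_C_mul_distinguished_mul_unit hf
    have hsep : (P.map (algebraMap 𝓞 K)).Separable := by
      rw [Polynomial.separable_def]
      have : IsAlgClosed (AlgCl p k K) := IsAlgClosure.isAlgClosed K
      rw [Polynomial.isCoprime_iff_aeval_ne_zero_of_isAlgClosed K (AlgCl p k K)]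
      -- A common root of `P` and `P'` lies in the open disk and is also a common root of `f` and
      -- `f'`.
      by_contra! hcop
      obtain ⟨x, hx1, hx2⟩ := hcop
      rw [Polynomial.derivative_map] at hx2
      rw [Polynomial.aeval_def, Polynomial.eval₂_map] at hx1 hx2
      have hx : ‖x‖ < 1 := by
        refine norm_lt_one_of_eval₂_eq_zero _ P hP.monic (fun n hn => ?_) hx1
        have := hP.mem hn
        rw [IsLocalRing.mem_maximalIdeal, mem_nonunits_iff, not_isUnit_ringOfIntegers_iff] at this
        exact this
      have hz : ‖(x : Cp p k K)‖ < 1 := by rwa [UniformSpace.Completion.norm_coe]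
      have hev (Q : Polynomial 𝓞)
          (hQ : Q.eval₂ ((algebraMap K (AlgCl p k K)).comp (algebraMap 𝓞 K)) x = 0) :
          evalCpHom p k (x : Cp p k K) hz Q = 0 := by
        rw [evalCpHom, evalOfNormLtOne_coe]
        have := Polynomial.hom_eval₂ Q
          ((algebraMap K (AlgCl p k K)).comp (algebraMap 𝓞 K))
          (UniformSpace.Completion.coeRingHom (α := AlgCl p k K)) x
        rw [hQ, map_zero] at this
        exact this.symm
      refine h x hz ?_ ?_
      · rw [← evalCpHom_apply p k _ hz, hfP, map_mul, map_mul, hev P hx1, zero_mul, mul_zero]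
      · rw [← evalCpHom_apply p k _ hz, hfP, Derivation.leibniz, Derivation.leibniz,
          PowerSeries.derivative_C, PowerSeries.derivative_coe]
        simp only [smul_eq_mul, map_mul, map_add, hev P hx1, hev _ hx2]
        simp
    obtain ⟨d, hd, hmem⟩ := exists_C_mem_span_pair_derivative hc hu hfP hsep
    obtain ⟨n, e, he⟩ := exists_dvd_p_pow p k hd
    refine ⟨n, ?_⟩
    have : (p : PowerSeries 𝓞) ^ n = PowerSeries.C e * PowerSeries.C d := by
      rw [← map_mul, mul_comm, ← he]
      simp
    rw [this]
    exact Ideal.mul_mem_left _ _ hmem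
  · rintro ⟨n, hn⟩ z hz h1 h2
    obtain ⟨a, b, hab⟩ := Ideal.mem_span_pair.1 hn
    -- Evaluating the relation at a common root would give `p ^ n = 0` in `C_p`.
    have := congrArg (evalCpHom p k z hz) hab
    rw [map_add, map_mul, map_mul, evalCpHom_apply p k z hz f, evalCpHom_apply p k z hz
      (PowerSeries.derivative 𝓞 f), h1, h2, mul_zero, mul_zero, add_zero] at this
    have h3 : ((p : Cp p k K)) ^ n = 0 := by simpa using this.symm
    have h4 : ‖(p : Cp p k K)‖ = (p : ℝ)⁻¹ := by
      rw [← norm_p_ringOfIntegers p k K, ← norm_integersToCp]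
      simp
    rw [eq_zero_of_pow_eq_zero h3, norm_zero] at h4
    exact inv_ne_zero (by exact_mod_cast (Fact.out : p.Prime).ne_zero) h4.symm

end

end PadicPowerSeries

end

theorem mainTheorem6 (p : ℕ) [Fact p.Prime]
    (k : Type*) [Field k] [CharP k p] [PerfectRing k p]
    (K : Type*) [Field K]
    [Algebra (FractionRing (WittVector p k)) K]
    [FiniteDimensional (FractionRing (WittVector p k)) K]
    [Algebra (WittVector p k) K]
    [IsScalarTower (WittVector p k) (FractionRing (WittVector p k)) K] :
    @IsOpen (PowerSeries (PadicPowerSeries.ringOfIntegers p k K))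
      (Ideal.span {(p : PowerSeries (PadicPowerSeries.ringOfIntegers p k K))}).adicTopology
      {f : PowerSeries (PadicPowerSeries.ringOfIntegers p k K) |
        PadicPowerSeries.HasOnlySimpleRoots p k f} := by
  let _ := (Ideal.span {(p : PowerSeries (PadicPowerSeries.ringOfIntegers p k K))}).adicTopology
  rw [isOpen_iff_mem_nhds]
  intro f hf
  obtain ⟨n, hn⟩ := (PadicPowerSeries.hasOnlySimpleRoots_iff p k f).1 hf
  obtain ⟨a, b, hab⟩ := Ideal.mem_span_pair.1 hn
  -- Exponent `n + 1` rather than `n`: the spare factor `p` is what makes `1 + p (a h + b D h)` a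
  -- unit.
  refine ((Ideal.hasBasis_nhds_adic _ f).mem_iff).2 ⟨n + 1, trivial, ?_⟩
  rintro _ ⟨y, hy, rfl⟩
  rw [SetLike.mem_coe, Ideal.span_singleton_pow, Ideal.mem_span_singleton] at hy
  obtain ⟨h, rfl⟩ := hy
  refine (PadicPowerSeries.hasOnlySimpleRoots_iff p k _).2 ⟨n, ?_⟩
  set D := PowerSeries.derivative (PadicPowerSeries.ringOfIntegers p k K)
  have hD : D (f + p ^ (n + 1) * h) = D f + p ^ (n + 1) * D h := by
    have := map_nsmul D (p ^ (n + 1)) h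
    rw [nsmul_eq_mul, nsmul_eq_mul, Nat.cast_pow] at this
    rw [map_add, this]
  have hu : IsUnit (1 + (p : PowerSeries (PadicPowerSeries.ringOfIntegers p k K)) *
      (a * h + b * D h)) := by
    rw [PowerSeries.isUnit_iff_constantCoeff, map_add, map_one, map_mul, map_natCast]
    rw [← sub_neg_eq_add]
    exact IsLocalRing.isUnit_one_sub_self_of_mem_nonunits _ (neg_mem
      (Ideal.mul_mem_right _ (IsLocalRing.maximalIdeal _)
        (PadicPowerSeries.p_mem_maximalIdeal p k K)))
  -- Up to this unit, the old coefficients `a` and `b` still produce `p ^ n`.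
  rw [← Ideal.mul_unit_mem_iff_mem _ hu, Ideal.mem_span_pair]
  refine ⟨a, b, ?_⟩
  rw [hD]
  linear_combination hab
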